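/- Let $H$ be a complex Hilbert space, with inner product conjugate linear in the first variable and linear in the second, and let $U$ be a unitary operator on $H$. Let $\mathbb{T}=\{z\in\mathbb{C}:|z|=1\}$, and let $L^\infty_0(\mathbb{T})$ be the $*$-algebra of bounded Borel measurable functions $f:\mathbb{T}\to\mathbb{C}$. For $f\in C(\mathbb{T})$, let $f(U)\in\mathcal{B}(H)$ be defined by the continuous calculus of $U$, that is, by the unique continuous homomorphism of algebras $C(\mathbb{T})\to\mathcal{B}(H)$ that sends the identity function $z\mapsto z$ to $U$. For $x\in H$ let $\mu_{x,x}$ be the finite positive Borel measure on $\mathbb{T}$ with $\langle x,f(U)x\rangle=\int_{\mathbb{T}}f\,d\mu_{x,x}$ for all $f\in C(\mathbb{T})$ (Riesz–Markov–Kakutani), and for $x,y\in H$ let $$\mu_{x,y}=\tfrac14\left(\mu_{x+y,x+y}-\mu_{x-y,x-y}-i\,\mu_{x+iy,x+iy}+i\,\mu_{x-iy,x-iy}\right),$$ the complex spectral measures of $U$ obtained by polarization. **A. Measurable calculus.** There is a unique linear map $\Lambda:L^\infty_0(\mathbb{T})\to\mathcal{B}(H)$, $\Lambda(f)=f(U)$,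 such that 1. $\Lambda(f)$ is the operator $f(U)$ of the continuous calculus if $f\in C(\mathbb{T})$; 2. if $f_n,f\in L^\infty_0(\mathbb{T})$, $\sup_n\sup_{z\in\mathbb{T}}|f_n(z)|<\infty$ and $f_n\to f$ pointwise, then $\Lambda(f_n)\to\Lambda(f)$ in the weak operator topology. Moreover, $\Lambda(fg)=\Lambda(f)\Lambda(g)$ and $\Lambda(f)^*=\Lambda(\overline{f})$ for all $f,g\in L^\infty_0(\mathbb{T})$, and for all $x,y\in H$ $$\langle x,f(U)y\rangle=\int_{\mathbb{T}}f\,d\mu_{x,y}.$$ **B. Projection valued measure.** For a Borel set $E\subseteq\mathbb{T}$ let $\mu(E)=\chi_E(U)$. Then $\langle x,\mu(E)y\rangle=\mu_{x,y}(E)$ for all $x,y\in H$, and $\mu$ is a projection valued measure on $\mathbb{T}$: each $\mu(E)$ is an orthogonal projection, $\mu(\emptyset)=0$, $\mu(\mathbb{T})=I$, and if $E_1,E_2,\dots$ are pairwise disjoint Borel sets, then $\mu\left(\bigcup_n E_n\right)=\sum_n\mu(E_n)$, with convergence in the strong operator topology. **C. Null sets and norms.** A Borel set $E$ is a null set of $\mu$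 if $\mu(E)=0$. For a Borel function $\varphi:\mathbb{T}\to\mathbb{C}$ let $\|\varphi\|_{L^\infty(\mu)}\in[0,\infty]$ be the infimum of the $C\in[0,\infty]$ such that $|\varphi|\le C$ outside a null set of $\mu$. 1. For a Borel set $E\subseteq\mathbb{T}$ the following are equivalent: (a) $\mu(E)=0$; (b) $\mu_{x,x}(E)=0$ for all $x\in H$; (c) $\mu_{x,y}(E)=0$ for all $x,y\in H$; and, for every given orthonormal basis $\{e_\alpha\}$ of $H$, (d) $\mu_{e_\alpha,e_\beta}(E)=0$ for all $\alpha,\beta$. 2. For every Borel function $\varphi:\mathbb{T}\to\mathbb{C}$, $\|\varphi\|_{L^\infty(\mu)}=\sup_{x\in H}\|\varphi\|_{L^\infty(\mu_{x,x})}$ in $[0,\infty]$. 3. For every $f\in L^\infty_0(\mathbb{T})$, $\|f(U)\|=\|f\|_{L^\infty(\mu)}$. -/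

import Mathlib

open MeasureTheory Filter Topology
open scoped ENNReal CompactlySupported

noncomputable section

namespace UnitaryCalculus

/-- The unit circle `𝕋 = {z ∈ ℂ : |z| = 1}`, with its Borel σ-algebra. -/
abbrev UnitCircle : Type := Metric.sphere (0 : ℂ) 1

/-- The space of bounded Borel measurable functions `𝕋 → ℂ` (actual functions, not classes modulo
null sets), as a star-subalgebra of the algebra of all functions. -/
def BoundedBorel : StarSubalgebra ℂ (UnitCircle → ℂ) where
  carrier := {f | Measurable f ∧ ∃ C : ℝ, ∀ z, ‖f z‖ ≤ C}
  mul_mem' := by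
    rintro f g ⟨hf, C, hC⟩ ⟨hg, D, hD⟩
    refine ⟨hf.mul hg, C * D, fun z => ?_⟩
    rw [Pi.mul_apply, norm_mul]
    exact mul_le_mul (hC z) (hD z) (norm_nonneg _) ((norm_nonneg _).trans (hC z))
  add_mem' := by
    rintro f g ⟨hf, C, hC⟩ ⟨hg, D, hD⟩
    exact ⟨hf.add hg, C + D, fun z => (norm_add_le _ _).trans (add_le_add (hC z) (hD z))⟩
  algebraMap_mem' := fun c => ⟨measurable_const, ‖c‖, fun _ => le_rfl⟩
  star_mem' := by
    rintro f ⟨hf, C, hC⟩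
    refine ⟨?_, C, fun z => ?_⟩
    · exact Complex.continuous_conj.measurable.comp hf
    · simpa using hC z

/-- A continuous function on the circle, seen as a bounded Borel function. -/
def BoundedBorel.ofContinuous (f : C(UnitCircle, ℂ)) : BoundedBorel :=
  ⟨f, f.continuous.measurable, ‖f‖, f.norm_coe_le_norm⟩

/-- The characteristic function of a Borel set, as a bounded Borel function. -/
def BoundedBorel.charFun (E : Set UnitCircle) (hE : MeasurableSet E) : BoundedBorel :=
  ⟨E.indicator 1, measurable_one.indicator hE, 1, fun z => by
    by_cases hz : z ∈ E <;> simp [hz]⟩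

variable {H : Type*} [NormedAddCommGroup H] [InnerProductSpace ℂ H] [CompleteSpace H]

/-! ### The continuous calculus -/

/-- The identity function `e(e^{it}) = e^{it}` of the circle. -/
def idFun : C(UnitCircle, ℂ) := ⟨Subtype.val, continuous_subtype_val⟩

lemma isStarNormal_unitary (U : unitary (H →L[ℂ] H)) : IsStarNormal (U : H →L[ℂ] H) :=
  isStarNormal_of_mem_unitary U.2

/-- The inclusion of the spectrum of a unitary operator in the circle. -/
def spectrumToCircle (U : unitary (H →L[ℂ] H)) :
    C(spectrum ℂ (U : H →L[ℂ] H), UnitCircle) :=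
  ⟨fun z => ⟨z, spectrum.subset_circle_of_unitary U.2 z.2⟩, by fun_prop⟩

/-- The continuous calculus `f ↦ f(U)`, `C(𝕋) → B(H)`, of a unitary operator `U`. -/
def contCalc (U : unitary (H →L[ℂ] H)) : C(UnitCircle, ℂ) →⋆ₐ[ℂ] (H →L[ℂ] H) :=
  (cfcHom (isStarNormal_unitary U)).comp
    (ContinuousMap.compStarAlgHom' ℂ ℂ (spectrumToCircle U))

lemma contCalc_idFun (U : unitary (H →L[ℂ] H)) : contCalc U idFun = U :=
  cfcHom_id (isStarNormal_unitary U)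

lemma norm_contCalc_le (U : unitary (H →L[ℂ] H)) (f : C(UnitCircle, ℂ)) :
    ‖contCalc U f‖ ≤ ‖f‖ := by
  change ‖cfcHom (isStarNormal_unitary U) (f.comp (spectrumToCircle U))‖ ≤ ‖f‖
  rw [norm_cfcHom _ _ (isStarNormal_unitary U)]
  exact (ContinuousMap.norm_le _ (norm_nonneg f)).2 fun z => f.norm_coe_le_norm _

/-- The continuous calculus is the only continuous homomorphism of algebras that sends the
identity function of the circle to `U`. -/
lemma contCalc_unique (U : unitary (H →L[ℂ] H)) (Φ : C(UnitCircle, ℂ) →ₐ[ℂ] (H →L[ℂ] H))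
    (hid : Φ idFun = U) (hcont : Continuous Φ) (f : C(UnitCircle, ℂ)) : Φ f = contCalc U f := by
  have hc : Continuous (contCalc U) :=
    AddMonoidHomClass.continuous_of_bound (contCalc U) 1 fun f => by
      simpa using norm_contCalc_le U f
  have h1 : idFun * star idFun = 1 := by
    ext z
    have hz : ‖(z : ℂ)‖ = 1 := by simp
    simp [idFun, Complex.mul_conj', hz]
  have key : ∀ g ∈ Algebra.adjoin ℂ ({idFun} ∪ star {idFun}), Φ g = contCalc U g := by
    intro g hg
    induction hg using Algebra.adjoin_induction with
    | mem g hg =>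
      rcases hg with hg | hg
      · rw [Set.mem_singleton_iff.1 hg, hid, contCalc_idFun]
      · have hg' : g = star idFun := by
          rw [← Set.mem_singleton_iff.1 (Set.mem_star.1 hg), star_star]
        have h2 : (U : H →L[ℂ] H) * Φ (star idFun) = 1 := by rw [← hid, ← map_mul, h1, map_one]
        rw [hg', map_star (contCalc U), contCalc_idFun]
        calc Φ (star idFun)
            = star (U : H →L[ℂ] H) * ((U : H →L[ℂ] H) * Φ (star idFun)) := by
              rw [← mul_assoc, Unitary.star_mul_self_of_mem U.2, one_mul]
          _ = star (U : H →L[ℂ] H) := by rw [h2, mul_one]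
    | algebraMap r => rw [AlgHomClass.commutes, AlgHomClass.commutes]
    | add a b _ _ ha hb => rw [map_add, map_add, ha, hb]
    | mul a b _ _ ha hb => rw [map_mul, map_mul, ha, hb]
  have hdense : f ∈ closure ((StarAlgebra.adjoin ℂ {idFun} : StarSubalgebra ℂ C(UnitCircle, ℂ)) :
      Set C(UnitCircle, ℂ)) := by
    have h := ContinuousMap.elemental_id_eq_top (𝕜 := ℂ) (Metric.sphere (0 : ℂ) 1)
    have hf : f ∈ (⊤ : StarSubalgebra ℂ C(UnitCircle, ℂ)) := trivial
    rw [← h] at hf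
    exact hf
  exact (isClosed_eq hcont hc).closure_subset_iff.2 (fun g hg => key g hg) hdense

/-! ### The spectral measures -/

/-- A real valued continuous function on the circle, seen as complex valued. -/
def toComplexFun (f : C_c(UnitCircle, ℝ)) : C(UnitCircle, ℂ) :=
  ⟨fun z => (f z : ℂ), Complex.continuous_ofReal.comp f.continuous⟩

/-- The functional `f ↦ ⟨x, f(U) x⟩` on real continuous functions (it takes real values there), as
a positive linear functional. -/
def diagFunctional (U : unitary (H →L[ℂ] H)) (x : H) : C_c(UnitCircle, ℝ) →ₚ[ℝ] ℝ :=
  PositiveLinearMap.mk₀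
    { toFun := fun f => (inner ℂ x (contCalc U (toComplexFun f) x)).re
      map_add' := fun f g => by
        have : toComplexFun (f + g) = toComplexFun f + toComplexFun g := by
          ext z; simp [toComplexFun]
        rw [this, map_add, add_apply, inner_add_right, Complex.add_re]
      map_smul' := fun c f => by
        have : toComplexFun (c • f) = (c : ℂ) • toComplexFun f := by
          ext z; simp [toComplexFun]
        rw [this, map_smul, smul_apply, inner_smul_right]
        simp }
    (by
      intro f hf
      let g : C(UnitCircle, ℂ) := ⟨fun z => (Real.sqrt (f z) : ℂ),
        Complex.continuous_ofReal.comp (Real.continuous_sqrt.comp f.continuous)⟩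
      have hg : toComplexFun f = star g * g := by
        ext z
        have hz : 0 ≤ f z := hf z
        simp [toComplexFun, g, ← Complex.ofReal_mul, Real.mul_self_sqrt hz]
      change 0 ≤ (inner ℂ x (contCalc U (toComplexFun f) x)).re
      rw [hg, map_mul, map_star, mul_apply_eq_comp,
        ContinuousLinearMap.star_eq_adjoint, ContinuousLinearMap.adjoint_inner_right]
      exact inner_self_nonneg (𝕜 := ℂ))

/-- The finite positive Borel measure `μ_{x,x}` that represents `f ↦ ⟨x, f(U) x⟩` by the
Riesz-Markov-Kakutani theorem. -/
def diagMeasure (U : unitary (H →L[ℂ] H)) (x : H) : Measure UnitCircle :=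
  RealRMK.rieszMeasure (diagFunctional U x)

instance (U : unitary (H →L[ℂ] H)) (x : H) : IsFiniteMeasure (diagMeasure U x) := by
  unfold diagMeasure; infer_instance

/-- The measure `μ_{x,x}`, as a complex measure. -/
def diagComplex (U : unitary (H →L[ℂ] H)) (x : H) : ComplexMeasure UnitCircle :=
  (diagMeasure U x).toSignedMeasure.toComplexMeasure 0

/-- The spectral measure `μ_{x,y}` of `U`, a complex Borel measure on the circle, obtained from
the measures `μ_{z,z}` by polarization (the inner product is linear in the second variable). -/
def spectralMeasure (U : unitary (H →L[ℂ] H)) (x y : H) : ComplexMeasure UnitCircle :=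
  (1 / 4 : ℂ) • (diagComplex U (x + y) - diagComplex U (x - y)
    - Complex.I • diagComplex U (x + Complex.I • y)
    + Complex.I • diagComplex U (x - Complex.I • y))

/-- The measure `μ_{x,x}` represents `f ↦ ⟨x, f(U) x⟩`. -/
lemma inner_contCalc_eq_integral (U : unitary (H →L[ℂ] H)) (x : H) (g : C_c(UnitCircle, ℝ)) :
    inner ℂ x (contCalc U (toComplexFun g) x) = ((∫ z, g z ∂diagMeasure U x : ℝ) : ℂ) := by
  rw [diagMeasure, RealRMK.integral_rieszMeasure]
  change _ = (((inner ℂ x (contCalc U (toComplexFun g) x)).re : ℝ) : ℂ)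
  have hsa : star (toComplexFun g) = toComplexFun g := by ext z; simp [toComplexFun]
  symm
  rw [← Complex.conj_eq_iff_re, inner_conj_symm, ← ContinuousLinearMap.adjoint_inner_right,
    ← ContinuousLinearMap.star_eq_adjoint, ← map_star, hsa]

lemma diagMeasure_smul (U : unitary (H →L[ℂ] H)) (c : ℂ) (x : H) :
    diagMeasure U (c • x) = (‖c‖₊ ^ 2) • diagMeasure U x := by
  refine ext_of_forall_integral_eq_of_IsFiniteMeasure fun f => ?_
  let a : C_c(UnitCircle, ℝ) := ⟨f.toContinuousMap, HasCompactSupport.of_compactSpace _⟩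
  have h := inner_contCalc_eq_integral U (c • x) a
  rw [map_smul, inner_smul_left, inner_smul_right, inner_contCalc_eq_integral, ← mul_assoc,
    mul_comm _ c, Complex.mul_conj'] at h
  have h2 : ∫ z, a z ∂diagMeasure U (c • x) = ‖c‖ ^ 2 * ∫ z, a z ∂diagMeasure U x := by
    exact_mod_cast h.symm
  rw [integral_smul_nnreal_measure]
  exact h2

lemma diagComplex_apply (U : unitary (H →L[ℂ] H)) (x : H) (E : Set UnitCircle)
    (hE : MeasurableSet E) : diagComplex U x E = ((diagMeasure U x).real E : ℂ) := by
  simp [diagComplex, SignedMeasure.toComplexMeasure_apply, hE]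
  rfl

/-- On the diagonal, polarization gives back the positive measure `μ_{x,x}`. -/
lemma spectralMeasure_self (U : unitary (H →L[ℂ] H)) (x : H) :
    spectralMeasure U x x = diagComplex U x := by
  have h1 : ∀ (c : ℂ) (E : Set UnitCircle), MeasurableSet E →
      diagComplex U (c • x) E = (‖c‖ : ℂ) ^ 2 * diagComplex U x E := by
    intro c E hE
    rw [diagComplex_apply U _ E hE, diagComplex_apply U _ E hE, diagMeasure_smul]
    simp [Measure.real]
  have e1 : x + x = (2 : ℂ) • x := (two_smul ℂ x).symm
  have e2 : x - x = (0 : ℂ) • x := by simp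
  have e3 : x + Complex.I • x = (1 + Complex.I) • x := by rw [add_smul, one_smul]
  have e4 : x - Complex.I • x = (1 - Complex.I) • x := by rw [sub_smul, one_smul]
  have n3 : ((‖1 + Complex.I‖ : ℝ) : ℂ) ^ 2 = 2 := by
    rw [← Complex.mul_conj']; simp; ring_nf; simp; norm_num
  have n4 : ((‖1 - Complex.I‖ : ℝ) : ℂ) ^ 2 = 2 := by
    rw [← Complex.mul_conj']; simp; ring_nf; simp; norm_num
  ext E hE
  rw [spectralMeasure, e1, e2, e3, e4]
  simp only [smul_apply, add_apply, sub_apply, h1 _ E hE, n3, n4]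
  simp
  ring

/-- The integral `∫ f dμ` of a complex function against a complex measure. -/
def complexIntegral (f : UnitCircle → ℂ) (μ : ComplexMeasure UnitCircle) : ℂ :=
  ∫ᵛ z, f z ∂[ContinuousLinearMap.mul ℝ ℂ; μ]

/-! ### The measurable calculus and projection valued measures -/

/-- `Λ` extends the continuous calculus of `U`, and it maps uniformly bounded, pointwise convergent
sequences of bounded Borel functions to sequences that converge in the weak operator topology. -/
structure IsMeasurableCalculus (U : unitary (H →L[ℂ] H))
    (Λ : BoundedBorel →ₗ[ℂ] (H →L[ℂ] H)) : Prop where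
  extends_contCalc : ∀ f : C(UnitCircle, ℂ), Λ (BoundedBorel.ofContinuous f) = contCalc U f
  tendsto_wot : ∀ (f : ℕ → BoundedBorel) (g : BoundedBorel) (C : ℝ),
    (∀ n z, ‖(f n : UnitCircle → ℂ) z‖ ≤ C) →
    (∀ z, Tendsto (fun n => (f n : UnitCircle → ℂ) z) atTop (𝓝 ((g : UnitCircle → ℂ) z))) →
    Tendsto (fun n => ContinuousLinearMapWOT.ofCLM (Λ (f n))) atTop
      (𝓝 (ContinuousLinearMapWOT.ofCLM (Λ g)))

/-- The set function `E ↦ χ_E(U)` on Borel sets (set to `0` on sets that are not Borel). -/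
def pvm (Λ : BoundedBorel →ₗ[ℂ] (H →L[ℂ] H)) (E : Set UnitCircle) : H →L[ℂ] H :=
  open Classical in if hE : MeasurableSet E then Λ (BoundedBorel.charFun E hE) else 0

/-- `μ` is a projection valued measure on the circle: its values on Borel sets are orthogonal
projections, `μ(∅) = 0`, `μ(𝕋) = I`, and `μ` is countably additive in the strong operator
topology. -/
structure IsProjectionValuedMeasure (μ : Set UnitCircle → (H →L[ℂ] H)) : Prop where
  isStarProjection : ∀ E, MeasurableSet E → IsStarProjection (μ E)
  empty : μ ∅ = 0
  univ : μ Set.univ = 1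
  hasSum_iUnion : ∀ E : ℕ → Set UnitCircle, (∀ n, MeasurableSet (E n)) →
    Pairwise (Function.onFun Disjoint E) → ∀ y : H, HasSum (fun n => μ (E n) y) (μ (⋃ n, E n) y)

/-- A null set of `μ` is a Borel set `E` with `μ(E) = 0`. -/
def IsNullSet (μ : Set UnitCircle → (H →L[ℂ] H)) (E : Set UnitCircle) : Prop :=
  MeasurableSet E ∧ μ E = 0

/-- The norm `‖φ‖_{L^∞(μ)} ∈ [0, ∞]`: the least `C` such that `|φ| ≤ C` holds `μ`-almost
everywhere, i.e. outside a null set of `μ`. -/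
def linftyNorm (μ : Set UnitCircle → (H →L[ℂ] H)) (φ : UnitCircle → ℂ) : ℝ≥0∞ :=
  sInf {C : ℝ≥0∞ | IsNullSet μ {z | ¬ ‖φ z‖ₑ ≤ C}}

end UnitaryCalculus

end

/-! A functional on bounded Borel functions that respects bounded pointwise convergence is
determined by its values on continuous functions, and also by its values on characteristic functions
(`ext_continuous`, `ext_charFun`). Integrals against the spectral measures are such functionals, so
identities known for the continuous calculus pass to bounded Borel functions.

In this way the polarized integral is sesquilinear in the two vectors (`polarIntegral_eq`). The
parallelogram law bounds it, and Riesz representation turns it into an operator. Any measurable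
calculus must have these same matrix coefficients (`inner_apply`), hence uniqueness. The same
principle gives adjoints, and products by extending one factor at a time.

The rest follows from the identity `norm_apply_sq`, that the squared norm of f(U)x is the integral
of |f|² against the measure of x. For f = χ_E it reduces null sets and strong countable additivity
to the scalar measures, and for general f it compares the operator norm with the essential supremum.
-/

noncomputable section

namespace UnitaryCalculus

/-! ### Bounded convergence and functional monotone class arguments -/

namespace BoundedBorel

/-- A sequence of bounded Borel functions converges boundedly if it is uniformly bounded and
converges pointwise. -/
def BoundedTendsto (f : ℕ → BoundedBorel) (g : BoundedBorel) : Prop :=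
  (∃ C : ℝ, ∀ n z, ‖(f n).1 z‖ ≤ C) ∧ ∀ z, Tendsto (fun n => (f n).1 z) atTop (𝓝 (g.1 z))

lemma measurable (f : BoundedBorel) : Measurable f.1 := f.2.1

lemma exists_bound (f : BoundedBorel) : ∃ C : ℝ, 0 ≤ C ∧ ∀ z, ‖f.1 z‖ ≤ C := by
  obtain ⟨C, hC⟩ := f.2.2
  exact ⟨|C|, abs_nonneg _, fun z => (hC z).trans (le_abs_self C)⟩

lemma integrable (f : BoundedBorel) (μ : Measure UnitCircle) [IsFiniteMeasure μ] :
    Integrable f.1 μ := by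
  obtain ⟨C, -, hC⟩ := exists_bound f
  exact Integrable.of_bound (measurable f).aestronglyMeasurable C (ae_of_all _ hC)

lemma BoundedTendsto.mul_left {f : ℕ → BoundedBorel} {g : BoundedBorel} (h : BoundedTendsto f g)
    (k : BoundedBorel) : BoundedTendsto (fun n => k * f n) (k * g) := by
  obtain ⟨⟨C, hC⟩, hlim⟩ := h
  obtain ⟨D, hD0, hD⟩ := exists_bound k
  refine ⟨⟨D * C, fun n z => ?_⟩, fun z => ?_⟩
  · change ‖k.1 z * (f n).1 z‖ ≤ _
    rw [norm_mul]
    exact mul_le_mul (hD z) (hC n z) (norm_nonneg _) hD0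
  · exact (hlim z).const_mul (k.1 z)

lemma BoundedTendsto.star {f : ℕ → BoundedBorel} {g : BoundedBorel} (h : BoundedTendsto f g) :
    BoundedTendsto (fun n => star (f n)) (star g) := by
  obtain ⟨⟨C, hC⟩, hlim⟩ := h
  refine ⟨⟨C, fun n z => ?_⟩, fun z => ?_⟩
  · change ‖Star.star ((f n).1 z)‖ ≤ _
    rw [norm_star]
    exact hC n z
  · exact (hlim z).star

/-- A subspace of bounded Borel functions that contains the characteristic functions and is closed
under bounded convergence is everything. -/
lemma mem_of_charFun_mem (V : Submodule ℂ BoundedBorel)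
    (hchar : ∀ E hE, charFun E hE ∈ V)
    (hlim : ∀ f g, (∀ n, f n ∈ V) → BoundedTendsto f g → g ∈ V) (g : BoundedBorel) : g ∈ V := by
  have hbdd : ∀ s : SimpleFunc UnitCircle ℂ, ∃ C : ℝ, ∀ z, ‖s z‖ ≤ C :=
    fun s => s.exists_forall_norm_le
  have hs : ∀ s : SimpleFunc UnitCircle ℂ, (⟨s, s.measurable, hbdd s⟩ : BoundedBorel) ∈ V := by
    intro s
    induction s using SimpleFunc.induction with
    | const c hE =>
      rename_i E
      convert V.smul_mem c (hchar E hE) using 1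
      ext z
      by_cases hz : z ∈ E <;> simp [charFun, hz]
    | add _ hf hg => exact V.add_mem hf hg
  obtain ⟨C, hC0, hC⟩ := exists_bound g
  -- Starting the approximation at the point 0 keeps every approximant below 2|g|, hence the uniform
  -- bound C + C.
  refine hlim (fun n => ⟨_, SimpleFunc.measurable _, hbdd (SimpleFunc.approxOn g.1 (measurable g)
    Set.univ 0 (Set.mem_univ 0) n)⟩) g (fun n => hs _) ⟨⟨C + C, fun n z => ?_⟩, fun z => ?_⟩
  · exact (SimpleFunc.norm_approxOn_zero_le (measurable g) (Set.mem_univ 0) z n).trans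
      (add_le_add (hC z) (hC z))
  · exact SimpleFunc.tendsto_approxOn (measurable g) (Set.mem_univ 0) (by simp)

/-- A subspace of bounded Borel functions that contains the continuous functions and is closed
under bounded convergence is everything. -/
lemma mem_of_continuous_mem (V : Submodule ℂ BoundedBorel)
    (hcont : ∀ f, ofContinuous f ∈ V)
    (hlim : ∀ f g, (∀ n, f n ∈ V) → BoundedTendsto f g → g ∈ V) (g : BoundedBorel) : g ∈ V := by
  refine mem_of_charFun_mem V (fun E hE => ?_) hlim g
  have hgen : (inferInstance : MeasurableSpace UnitCircle) =
      MeasurableSpace.generateFrom {s | IsClosed s} :=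
    BorelSpace.measurable_eq.trans borel_eq_generateFrom_isClosed
  induction E, hE using MeasurableSpace.induction_on_inter hgen isPiSystem_isClosed with
  | empty =>
    convert V.zero_mem using 1
    ext z
    simp [charFun]
  | basic F hF =>
    -- Closed sets form a π-system generating the Borel sets. The indicator of a closed set is the
    -- bounded limit of continuous functions supported near it.
    let φ : ℕ → C(UnitCircle, ℂ) := fun n =>
      ⟨fun z => ((thickenedIndicator (δ := 1 / ((n : ℝ) + 1)) (by positivity) F z : ℝ) : ℂ),
        by fun_prop⟩
    refine hlim (fun n => ofContinuous (φ n)) _ (fun n => hcont _) ⟨⟨1, fun n z => ?_⟩, fun z => ?_⟩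
    · have := thickenedIndicator_le_one (δ := 1 / ((n : ℝ) + 1)) (by positivity) F z
      simpa [ofContinuous, φ] using this
    · have h := thickenedIndicator_tendsto_indicator_closure
        (δseq := fun n : ℕ => 1 / ((n : ℝ) + 1)) (fun n => by positivity)
        tendsto_one_div_add_atTop_nhds_zero_nat F
      have h2 := (tendsto_pi_nhds.1 h) z
      rw [IsClosed.closure_eq (X := UnitCircle) hF] at h2
      have h3 := (Complex.continuous_ofReal.comp NNReal.continuous_coe).continuousAt.tendsto.comp h2
      convert h3 using 2
      · rfl
      · by_cases hz : z ∈ F <;> simp [charFun, hz]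
  | compl E hE ih =>
    convert V.sub_mem (hcont 1) ih using 1
    ext z
    by_cases hz : z ∈ E <;> simp [charFun, ofContinuous, hz]
  | iUnion E hd hE ih =>
    -- Disjointness makes each partial sum the indicator of a finite union. So the sums are bounded
    -- by 1, and at each point they are eventually constant.
    refine hlim (fun n => ∑ i ∈ Finset.range n, charFun (E i) (hE i)) _
      (fun n => V.sum_mem fun i _ => ih i) ?_
    have hsum : ∀ n z, ((∑ i ∈ Finset.range n, charFun (E i) (hE i) : BoundedBorel).1 z) =
        (⋃ i ∈ Finset.range n, E i).indicator 1 z := by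
      intro n z
      rw [Finset.indicator_biUnion _ _ (fun i _ j _ hij => hd hij)]
      simp [charFun]
    refine ⟨⟨1, fun n z => ?_⟩, fun z => ?_⟩
    · rw [hsum]
      by_cases hz : z ∈ (⋃ i ∈ Finset.range n, E i)
      · rw [Set.indicator_of_mem hz]; simp
      · rw [Set.indicator_of_notMem hz]; simp
    · simp only [hsum]
      by_cases hz : z ∈ ⋃ i, E i
      · obtain ⟨i, hi⟩ := Set.mem_iUnion.1 hz
        refine tendsto_const_nhds.congr' ?_
        filter_upwards [eventually_gt_atTop i] with n hn
        have hn' : z ∈ ⋃ i ∈ Finset.range n, E i :=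
          Set.mem_biUnion (Finset.mem_coe.2 (Finset.mem_range.2 hn)) hi
        rw [Set.indicator_of_mem hn']
        simp only [charFun]
        rw [Set.indicator_of_mem hz]
      · refine tendsto_const_nhds.congr fun n => ?_
        simp only [charFun]
        rw [Set.indicator_of_notMem hz, Set.indicator_of_notMem]
        exact fun h => hz (Set.iUnion₂_subset (fun i _ => Set.subset_iUnion E i) h)

/-- A linear functional on bounded Borel functions that is continuous for bounded convergence. -/
def IsBoundedlyContinuous (L : BoundedBorel →ₗ[ℂ] ℂ) : Prop :=
  ∀ f g, BoundedTendsto f g → Tendsto (fun n => L (f n)) atTop (𝓝 (L g))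

namespace IsBoundedlyContinuous

variable {L M : BoundedBorel →ₗ[ℂ] ℂ}

lemma add (hL : IsBoundedlyContinuous L) (hM : IsBoundedlyContinuous M) :
    IsBoundedlyContinuous (L + M) := fun f g h => (hL f g h).add (hM f g h)

lemma sub (hL : IsBoundedlyContinuous L) (hM : IsBoundedlyContinuous M) :
    IsBoundedlyContinuous (L - M) := fun f g h => (hL f g h).sub (hM f g h)

lemma smul (hL : IsBoundedlyContinuous L) (c : ℂ) :
    IsBoundedlyContinuous (c • L) := fun f g h => (hL f g h).const_mul c

/-- Functionals that are continuous for bounded convergence and agree on continuous functions are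
equal. -/
lemma ext_continuous (hL : IsBoundedlyContinuous L) (hM : IsBoundedlyContinuous M)
    (h : ∀ f, L (ofContinuous f) = M (ofContinuous f)) : L = M := by
  ext g
  refine mem_of_continuous_mem (LinearMap.eqLocus L M) h (fun f g hf hfg => ?_) g
  refine tendsto_nhds_unique (hL f g hfg) ?_
  simpa only [show ∀ n, L (f n) = M (f n) from hf] using hM f g hfg

/-- Functionals that are continuous for bounded convergence and agree on characteristic functions
are equal. -/
lemma ext_charFun (hL : IsBoundedlyContinuous L) (hM : IsBoundedlyContinuous M)
    (h : ∀ E hE, L (charFun E hE) = M (charFun E hE)) : L = M := by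
  ext g
  refine mem_of_charFun_mem (LinearMap.eqLocus L M) h (fun f g hf hfg => ?_) g
  refine tendsto_nhds_unique (hL f g hfg) ?_
  simpa only [show ∀ n, L (f n) = M (f n) from hf] using hM f g hfg

end IsBoundedlyContinuous

/-- Integration against a finite measure. -/
def integralₗ (μ : Measure UnitCircle) [IsFiniteMeasure μ] : BoundedBorel →ₗ[ℂ] ℂ where
  toFun f := ∫ z, f.1 z ∂μ
  map_add' f g := integral_add (integrable f μ) (integrable g μ)
  map_smul' c f := integral_const_mul c f.1

lemma isBoundedlyContinuous_integralₗ (μ : Measure UnitCircle) [IsFiniteMeasure μ] :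
    IsBoundedlyContinuous (integralₗ μ) := by
  rintro f g ⟨⟨C, hC⟩, hlim⟩
  exact tendsto_integral_of_dominated_convergence (fun _ => C)
    (fun n => (measurable (f n)).aestronglyMeasurable) (integrable_const C)
    (fun n => ae_of_all _ (hC n)) (ae_of_all _ hlim)

lemma integralₗ_charFun (μ : Measure UnitCircle) [IsFiniteMeasure μ] (E : Set UnitCircle)
    (hE : MeasurableSet E) : integralₗ μ (charFun E hE) = (μ.real E : ℂ) := by
  change ∫ z, E.indicator 1 z ∂μ = _
  rw [integral_indicator hE]
  simp

end BoundedBorel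

/-! ### Integrals against the spectral measures, by polarization -/

open BoundedBorel ComplexConjugate

variable {H : Type*} [NormedAddCommGroup H] [InnerProductSpace ℂ H] [CompleteSpace H]

/-- The functional `f ↦ ∫ f dμ_{x,x}`. -/
def diagIntegral (U : unitary (H →L[ℂ] H)) (x : H) : BoundedBorel →ₗ[ℂ] ℂ :=
  integralₗ (diagMeasure U x)

lemma isBoundedlyContinuous_diagIntegral (U : unitary (H →L[ℂ] H)) (x : H) :
    IsBoundedlyContinuous (diagIntegral U x) :=
  isBoundedlyContinuous_integralₗ _

/-- The Riesz measure represents the functional on real functions; real and imaginary parts extend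
this to complex ones. -/
lemma diagIntegral_ofContinuous (U : unitary (H →L[ℂ] H)) (x : H) (f : C(UnitCircle, ℂ)) :
    diagIntegral U x (ofContinuous f) = inner ℂ x (contCalc U f x) := by
  let a : C_c(UnitCircle, ℝ) := ⟨⟨fun z => (f z).re, by fun_prop⟩,
    HasCompactSupport.of_compactSpace _⟩
  let b : C_c(UnitCircle, ℝ) := ⟨⟨fun z => (f z).im, by fun_prop⟩,
    HasCompactSupport.of_compactSpace _⟩
  have hreal : ∀ g : C_c(UnitCircle, ℝ),
      diagIntegral U x (ofContinuous (toComplexFun g)) =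
        inner ℂ x (contCalc U (toComplexFun g) x) := by
    intro g
    rw [inner_contCalc_eq_integral, ← integral_complex_ofReal]
    rfl
  have hf : f = toComplexFun a + Complex.I • toComplexFun b := by
    ext z
    change f z = ((f z).re : ℂ) + Complex.I * ((f z).im : ℂ)
    rw [mul_comm, Complex.re_add_im]
  have hf' : ofContinuous f =
      ofContinuous (toComplexFun a) + Complex.I • ofContinuous (toComplexFun b) := by
    conv_lhs => rw [hf]
    rfl
  rw [hf', map_add, map_smul, hreal, hreal]
  conv_rhs => rw [hf]
  simp

/-- The functional `f ↦ ∫ f dμ_{x,y}`, obtained by polarization. -/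
def polarIntegral (U : unitary (H →L[ℂ] H)) (x y : H) : BoundedBorel →ₗ[ℂ] ℂ :=
  (1 / 4 : ℂ) • (diagIntegral U (x + y) - diagIntegral U (x - y)
    - Complex.I • diagIntegral U (x + Complex.I • y)
    + Complex.I • diagIntegral U (x - Complex.I • y))

lemma isBoundedlyContinuous_polarIntegral (U : unitary (H →L[ℂ] H)) (x y : H) :
    IsBoundedlyContinuous (polarIntegral U x y) := by
  have h := isBoundedlyContinuous_diagIntegral U
  exact ((((h _).sub (h _)).sub ((h _).smul _)).add ((h _).smul _)).smul _

lemma polarIntegral_ofContinuous (U : unitary (H →L[ℂ] H)) (x y : H) (f : C(UnitCircle, ℂ)) :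
    polarIntegral U x y (ofContinuous f) = inner ℂ x (contCalc U f y) := by
  simp only [polarIntegral, LinearMap.smul_apply, LinearMap.add_apply, LinearMap.sub_apply,
    diagIntegral_ofContinuous, map_add, map_sub, map_smul, inner_add_left, inner_sub_left,
    inner_add_right, inner_sub_right, inner_smul_left, inner_smul_right, smul_eq_mul,
    Complex.conj_I]
  ring_nf
  simp only [Complex.I_sq]
  ring

/-- The working tool: additivity and homogeneity in each vector, as well as adjoints and products,
need checking only on continuous functions. -/
lemma polarIntegral_eq (U : unitary (H →L[ℂ] H)) (x y : H) {L : BoundedBorel →ₗ[ℂ] ℂ}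
    (hL : IsBoundedlyContinuous L)
    (h : ∀ f, L (ofContinuous f) = inner ℂ x (contCalc U f y)) : polarIntegral U x y = L :=
  (isBoundedlyContinuous_polarIntegral U x y).ext_continuous hL fun f => by
    rw [h, polarIntegral_ofContinuous]

lemma polarIntegral_self (U : unitary (H →L[ℂ] H)) (x : H) :
    polarIntegral U x x = diagIntegral U x :=
  polarIntegral_eq U x x (isBoundedlyContinuous_diagIntegral U x) (diagIntegral_ofContinuous U x)

lemma polarIntegral_add_left (U : unitary (H →L[ℂ] H)) (x x' y : H) :
    polarIntegral U (x + x') y = polarIntegral U x y + polarIntegral U x' y :=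
  polarIntegral_eq U _ _ ((isBoundedlyContinuous_polarIntegral U x y).add
    (isBoundedlyContinuous_polarIntegral U x' y)) fun f => by
      simp [polarIntegral_ofContinuous]

lemma polarIntegral_add_right (U : unitary (H →L[ℂ] H)) (x y y' : H) :
    polarIntegral U x (y + y') = polarIntegral U x y + polarIntegral U x y' :=
  polarIntegral_eq U _ _ ((isBoundedlyContinuous_polarIntegral U x y).add
    (isBoundedlyContinuous_polarIntegral U x y')) fun f => by
      simp [polarIntegral_ofContinuous]

lemma polarIntegral_smul_left (U : unitary (H →L[ℂ] H)) (c : ℂ) (x y : H) :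
    polarIntegral U (c • x) y = conj c • polarIntegral U x y :=
  polarIntegral_eq U _ _ ((isBoundedlyContinuous_polarIntegral U x y).smul _) fun f => by
      rw [LinearMap.smul_apply, polarIntegral_ofContinuous, inner_smul_left, smul_eq_mul]

lemma polarIntegral_smul_right (U : unitary (H →L[ℂ] H)) (c : ℂ) (x y : H) :
    polarIntegral U x (c • y) = c • polarIntegral U x y :=
  polarIntegral_eq U _ _ ((isBoundedlyContinuous_polarIntegral U x y).smul _) fun f => by
      simp [polarIntegral_ofContinuous]

lemma diagMeasure_real_univ (U : unitary (H →L[ℂ] H)) (x : H) :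
    (diagMeasure U x).real Set.univ = ‖x‖ ^ 2 := by
  have h := diagIntegral_ofContinuous U x 1
  have h1 : diagIntegral U x (ofContinuous 1) = ((diagMeasure U x).real Set.univ : ℂ) := by
    change ∫ _, (1 : ℂ) ∂diagMeasure U x = _
    simp
  rw [h1, map_one, one_apply_eq_self, inner_self_eq_norm_sq_to_K] at h
  exact Complex.ofReal_injective (h.trans (Complex.ofReal_pow ‖x‖ 2).symm)

lemma norm_diagIntegral_le (U : unitary (H →L[ℂ] H)) (x : H) (f : BoundedBorel) {C : ℝ}
    (hC : ∀ z, ‖f.1 z‖ ≤ C) : ‖diagIntegral U x f‖ ≤ C * ‖x‖ ^ 2 := by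
  rw [← diagMeasure_real_univ U x]
  exact norm_integral_le_of_norm_le_const (ae_of_all _ hC)

/-- Each diagonal measure has mass equal to the squared norm of its vector. Two parallelogram laws
add the four masses to 4(‖x‖² + ‖y‖²), and the factor 1/4 cancels the 4. -/
lemma norm_polarIntegral_le_add (U : unitary (H →L[ℂ] H)) (x y : H) (f : BoundedBorel) {C : ℝ}
    (hC : ∀ z, ‖f.1 z‖ ≤ C) : ‖polarIntegral U x y f‖ ≤ C * (‖x‖ ^ 2 + ‖y‖ ^ 2) := by
  have h := fun w => norm_diagIntegral_le U w f hC
  have p1 := parallelogram_law_with_norm ℂ x y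
  have p2 := parallelogram_law_with_norm ℂ x (Complex.I • y)
  rw [norm_smul, Complex.norm_I, one_mul] at p2
  simp only [polarIntegral, LinearMap.smul_apply, LinearMap.add_apply, LinearMap.sub_apply,
    smul_eq_mul]
  rw [norm_mul]
  have e1 := norm_add_le (diagIntegral U (x + y) f - diagIntegral U (x - y) f
    - Complex.I * diagIntegral U (x + Complex.I • y) f)
    (Complex.I * diagIntegral U (x - Complex.I • y) f)
  have e2 := norm_sub_le (diagIntegral U (x + y) f - diagIntegral U (x - y) f)
    (Complex.I * diagIntegral U (x + Complex.I • y) f)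
  have e3 := norm_sub_le (diagIntegral U (x + y) f) (diagIntegral U (x - y) f)
  rw [norm_mul, Complex.norm_I, one_mul] at e1 e2
  have h1 := h (x + y)
  have h2 := h (x - y)
  have h3 := h (x + Complex.I • y)
  have h4 := h (x - Complex.I • y)
  have q : C * ‖x + y‖ ^ 2 + C * ‖x - y‖ ^ 2 + C * ‖x + Complex.I • y‖ ^ 2
      + C * ‖x - Complex.I • y‖ ^ 2 = 4 * (C * (‖x‖ ^ 2 + ‖y‖ ^ 2)) := by
    linear_combination C * p1 + C * p2
  have n4 : ‖(1 / 4 : ℂ)‖ = 1 / 4 := by norm_num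
  rw [n4]
  linarith

lemma norm_polarIntegral_le (U : unitary (H →L[ℂ] H)) (x y : H) (f : BoundedBorel) {C : ℝ}
    (hC : ∀ z, ‖f.1 z‖ ≤ C) : ‖polarIntegral U x y f‖ ≤ 2 * C * ‖x‖ * ‖y‖ := by
  rcases eq_or_ne x 0 with rfl | hx
  · have : polarIntegral U 0 y = 0 := by
      simpa using polarIntegral_smul_left U 0 0 y
    simp [this]
  rcases eq_or_ne y 0 with rfl | hy
  · have : polarIntegral U x 0 = 0 := by
      simpa using polarIntegral_smul_right U 0 x 0
    simp [this]
  have hx' : 0 < ‖x‖ := norm_pos_iff.2 hx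
  have hy' : 0 < ‖y‖ := norm_pos_iff.2 hy
  -- Rescaling gives both vectors the norm ‖x‖‖y‖, so the sum of squares becomes 2‖x‖²‖y‖². The
  -- factor 2 is harmless, as only boundedness of the form is needed.
  have h := norm_polarIntegral_le_add U (((‖y‖ : ℝ) : ℂ) • x) (((‖x‖ : ℝ) : ℂ) • y) f hC
  rw [polarIntegral_smul_left, polarIntegral_smul_right] at h
  simp only [LinearMap.smul_apply, norm_smul, RCLike.norm_conj, Complex.norm_real, norm_norm] at h
  have hpos : 0 < ‖y‖ * ‖x‖ := mul_pos hy' hx'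
  refine le_of_mul_le_mul_left ?_ hpos
  linarith

/-! ### From sesquilinear forms to the calculus -/

/-- The sesquilinear form `(x, y) ↦ ∫ f dμ_{x,y}`. -/
def polarForm (U : unitary (H →L[ℂ] H)) (f : BoundedBorel) : H →L⋆[ℂ] H →L[ℂ] ℂ :=
  LinearMap.mkContinuous₂
    (LinearMap.mk₂'ₛₗ (starRingEnd ℂ) (RingHom.id ℂ) (fun x y => polarIntegral U x y f)
      (fun x x' y => by rw [polarIntegral_add_left]; rfl)
      (fun c x y => by rw [polarIntegral_smul_left]; rfl)
      (fun x y y' => by rw [polarIntegral_add_right]; rfl)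
      (fun c x y => by rw [polarIntegral_smul_right]; rfl))
    (2 * (exists_bound f).choose)
    (fun x y => norm_polarIntegral_le U x y f (exists_bound f).choose_spec.2)

lemma exists_inner_eq_polarIntegral (U : unitary (H →L[ℂ] H)) (f : BoundedBorel) :
    ∃ T : H →L[ℂ] H, ∀ x y, inner ℂ x (T y) = polarIntegral U x y f := by
  -- The operator representing the form acts on the first slot of the inner product; the adjoint
  -- moves it to the second.
  refine ⟨star (InnerProductSpace.continuousLinearMapOfBilin (polarForm U f)), fun x y => ?_⟩
  rw [ContinuousLinearMap.star_eq_adjoint, ContinuousLinearMap.adjoint_inner_right,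
    InnerProductSpace.continuousLinearMapOfBilin_apply]
  rfl

lemma isBoundedlyContinuous_inner {U : unitary (H →L[ℂ] H)}
    {Λ : BoundedBorel →ₗ[ℂ] (H →L[ℂ] H)} (hΛ : IsMeasurableCalculus U Λ) (x y : H)
    {L : BoundedBorel →ₗ[ℂ] ℂ} (hL : ∀ f, L f = inner ℂ x (Λ f y)) :
    IsBoundedlyContinuous L := by
  rintro f g ⟨⟨C, hC⟩, hlim⟩
  simp only [hL]
  exact ContinuousLinearMapWOT.tendsto_iff_forall_inner_apply_tendsto.1
    (hΛ.tendsto_wot f g C hC hlim) y x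

lemma exists_isMeasurableCalculus (U : unitary (H →L[ℂ] H)) :
    ∃ Λ : BoundedBorel →ₗ[ℂ] (H →L[ℂ] H), IsMeasurableCalculus U Λ := by
  choose T hT using exists_inner_eq_polarIntegral U
  refine ⟨⟨⟨T, fun f g => ?_⟩, fun c f => ?_⟩, fun f => ?_, fun f g C hC hlim => ?_⟩
  · ext y
    refine ext_inner_left ℂ fun x => ?_
    rw [add_apply, inner_add_right, hT, hT, hT, map_add]
  · ext y
    refine ext_inner_left ℂ fun x => ?_
    rw [RingHom.id_apply, smul_apply, inner_smul_right, hT, hT, map_smul, smul_eq_mul]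
  · ext y
    refine ext_inner_left ℂ fun x => ?_
    exact (hT _ x y).trans (polarIntegral_ofContinuous U x y f)
  · refine ContinuousLinearMapWOT.tendsto_iff_forall_inner_apply_tendsto.2 fun y x => ?_
    change Tendsto (fun n => inner ℂ x (T (f n) y)) atTop (𝓝 (inner ℂ x (T g y)))
    simp only [hT]
    exact isBoundedlyContinuous_polarIntegral U x y f g ⟨⟨C, hC⟩, hlim⟩

/-! ### Uniqueness, adjoints and products -/

namespace IsMeasurableCalculus

variable {U : unitary (H →L[ℂ] H)} {Λ : BoundedBorel →ₗ[ℂ] (H →L[ℂ] H)}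

lemma inner_apply (hΛ : IsMeasurableCalculus U Λ) (f : BoundedBorel) (x y : H) :
    inner ℂ x (Λ f y) = polarIntegral U x y f := by
  let L : BoundedBorel →ₗ[ℂ] ℂ :=
    { toFun := fun f => inner ℂ x (Λ f y)
      map_add' := fun f g => by rw [map_add, add_apply, inner_add_right]
      map_smul' := fun c f => by rw [map_smul, smul_apply, inner_smul_right]; rfl }
  rw [polarIntegral_eq U x y (isBoundedlyContinuous_inner hΛ x y (L := L) fun f => rfl) fun f => by
    change inner ℂ x (Λ (ofContinuous f) y) = _
    rw [hΛ.extends_contCalc]]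
  rfl

lemma unique (hΛ : IsMeasurableCalculus U Λ) {Λ' : BoundedBorel →ₗ[ℂ] (H →L[ℂ] H)}
    (hΛ' : IsMeasurableCalculus U Λ') : Λ = Λ' := by
  ext f y
  exact ext_inner_left ℂ fun x => by rw [hΛ.inner_apply, hΛ'.inner_apply]

lemma inner_self_apply (hΛ : IsMeasurableCalculus U Λ) (f : BoundedBorel) (x : H) :
    inner ℂ x (Λ f x) = ∫ z, f.1 z ∂diagMeasure U x := by
  rw [hΛ.inner_apply, polarIntegral_self]; rfl

lemma star_apply (hΛ : IsMeasurableCalculus U Λ) (f : BoundedBorel) : star (Λ f) = Λ (star f) := by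
  have key : ∀ x y, inner ℂ x (Λ f y) = inner ℂ x (star (Λ (star f)) y) := by
    intro x y
    -- The two conjugations cancel, so this functional is linear in f. On continuous functions it
    -- agrees with the coefficient of f(U).
    let L : BoundedBorel →ₗ[ℂ] ℂ :=
      { toFun := fun f => inner ℂ x (star (Λ (star f)) y)
        map_add' := fun f g => by rw [star_add, map_add, star_add, add_apply, inner_add_right]
        map_smul' := fun c f => by
          rw [star_smul, map_smul, star_smul, smul_apply, inner_smul_right, star_star]; rfl }
    have hL : ∀ f, L f = conj (inner ℂ y (Λ (star f) x)) := by
      intro f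
      change inner ℂ x (star (Λ (star f)) y) = _
      rw [ContinuousLinearMap.star_eq_adjoint, ContinuousLinearMap.adjoint_inner_right,
        inner_conj_symm]
    have hLc : IsBoundedlyContinuous L := by
      intro f g hfg
      obtain ⟨⟨C, hC⟩, hlim⟩ := hfg.star
      simp only [hL]
      exact (Complex.continuous_conj.tendsto _).comp
        (ContinuousLinearMapWOT.tendsto_iff_forall_inner_apply_tendsto.1
          (hΛ.tendsto_wot _ _ C hC hlim) x y)
    rw [hΛ.inner_apply, polarIntegral_eq U x y hLc fun f => ?_]
    · rfl
    · change inner ℂ x (star (Λ (ofContinuous (star f))) y) = _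
      rw [hΛ.extends_contCalc, map_star, star_star]
  rw [star_eq_iff_star_eq, eq_comm]
  ext y
  exact ext_inner_left ℂ fun x => key x y

lemma mul_apply (hΛ : IsMeasurableCalculus U Λ) (f g : BoundedBorel) :
    Λ (f * g) = Λ f * Λ g := by
  have inner_mul : ∀ (S T : H →L[ℂ] H) (x y : H),
      inner ℂ x ((S * T) y) = inner ℂ (star S x) (T y) := by
    intro S T x y
    rw [mul_apply_eq_comp, ContinuousLinearMap.star_eq_adjoint,
      ContinuousLinearMap.adjoint_inner_left]
  have mulL : ∀ (k : BoundedBorel) (x y : H), ∃ L : BoundedBorel →ₗ[ℂ] ℂ,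
      IsBoundedlyContinuous L ∧ ∀ f, L f = inner ℂ x (Λ (k * f) y) := by
    intro k x y
    refine ⟨polarIntegral U x y ∘ₗ LinearMap.mulLeft ℂ k, fun f g hfg => ?_, fun f => ?_⟩
    · exact isBoundedlyContinuous_polarIntegral U x y _ _ (hfg.mul_left k)
    · rw [hΛ.inner_apply]; rfl
  -- With f continuous, the coefficients of Λ(fg) are boundedly continuous in g. For continuous g
  -- they are the coefficients of g(U) at the vectors Λ(f)*x and y.
  have hcont : ∀ (f : C(UnitCircle, ℂ)) (g : BoundedBorel),
      Λ (ofContinuous f * g) = Λ (ofContinuous f) * Λ g := by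
    intro f g
    ext y
    refine ext_inner_left ℂ fun x => ?_
    obtain ⟨L, hL, hLf⟩ := mulL (ofContinuous f) x y
    rw [inner_mul, hΛ.inner_apply g, polarIntegral_eq U _ _ hL fun k => ?_, hLf]
    rw [hLf, show ofContinuous f * ofContinuous k = ofContinuous (f * k) from rfl,
      hΛ.extends_contCalc, hΛ.extends_contCalc, map_mul, inner_mul]
  ext y
  refine ext_inner_left ℂ fun x => ?_
  -- Now g is fixed and f varies; for continuous f the previous case identifies the functional with
  -- the one at x and Λ(g)y.
  obtain ⟨L, hL, hLf⟩ := mulL g x y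
  rw [mul_apply_eq_comp, hΛ.inner_apply f, polarIntegral_eq U _ _ hL fun k => ?_, hLf,
    mul_comm]
  rw [hLf, mul_comm, hcont, hΛ.extends_contCalc, mul_apply_eq_comp]

end IsMeasurableCalculus

/-! ### Integration against the complex spectral measures -/

/-- Integration against a complex measure of finite variation. -/
def complexIntegralₗ (μ : ComplexMeasure UnitCircle) [IsFiniteMeasure μ.variation] :
    BoundedBorel →ₗ[ℂ] ℂ where
  toFun f := complexIntegral f.1 μ
  map_add' f g :=
    VectorMeasure.integral_add (integrable f μ.variation) (integrable g μ.variation)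
  map_smul' c f := by
    have h : complexIntegral (c • f.1) μ = c • complexIntegral f.1 μ := by
      rw [complexIntegral, complexIntegral, VectorMeasure.integral_eq_setToFun,
        VectorMeasure.integral_eq_setToFun]
      -- The integral is built from a real bilinear pairing, so complex homogeneity rests on the
      -- pairing commuting with complex scalars.
      refine setToFun_smul _ (fun c s x => ?_) c f.1
      change c • x * μ s = c • (x * μ s)
      rw [smul_mul_assoc]
    exact h

lemma isBoundedlyContinuous_complexIntegralₗ (μ : ComplexMeasure UnitCircle)
    [IsFiniteMeasure μ.variation] : IsBoundedlyContinuous (complexIntegralₗ μ) := by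
  rintro f g ⟨⟨C, hC⟩, hlim⟩
  exact tendsto_setToFun_of_dominated_convergence _ (fun _ => C)
    (fun n => (measurable (f n)).aestronglyMeasurable) (integrable_const C)
    (fun n => ae_of_all _ (hC n)) (ae_of_all _ hlim)

lemma complexIntegralₗ_charFun (μ : ComplexMeasure UnitCircle) [IsFiniteMeasure μ.variation]
    (E : Set UnitCircle) (hE : MeasurableSet E) : complexIntegralₗ μ (charFun E hE) = μ E := by
  change complexIntegral (E.indicator fun _ => 1) μ = μ E
  rw [complexIntegral, VectorMeasure.integral_eq_setToFun,
    setToFun_indicator_const _ hE (measure_ne_top _ _)]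
  exact one_mul (μ E)

lemma pvm_of_measurableSet {H : Type*} [NormedAddCommGroup H] [InnerProductSpace ℂ H]
    (Λ : BoundedBorel →ₗ[ℂ] (H →L[ℂ] H)) {E : Set UnitCircle} (hE : MeasurableSet E) :
    pvm Λ E = Λ (charFun E hE) := dif_pos hE

/-- Positivity gives the domination. It makes the variation of the polarized measures finite, as
dominated convergence requires. -/
lemma variation_diagComplex_le (U : unitary (H →L[ℂ] H)) (x : H) :
    (diagComplex U x).variation ≤ diagMeasure U x :=
  VectorMeasure.variation_le_of_forall_enorm_le fun E hE => by
    rw [diagComplex_apply U x E hE, ← ofReal_norm, Complex.norm_real, Real.norm_of_nonneg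
      measureReal_nonneg, ofReal_measureReal]

instance (U : unitary (H →L[ℂ] H)) (x : H) : IsFiniteMeasure (diagComplex U x).variation :=
  isFiniteMeasure_of_le _ (variation_diagComplex_le U x)

instance (U : unitary (H →L[ℂ] H)) (x y : H) :
    IsFiniteMeasure (spectralMeasure U x y).variation := by
  have hadd : ∀ μ ν : ComplexMeasure UnitCircle, IsFiniteMeasure μ.variation →
      IsFiniteMeasure ν.variation → IsFiniteMeasure (μ + ν).variation := fun μ ν _ _ =>
    isFiniteMeasure_of_le _ VectorMeasure.variation_add_le
  have hsub : ∀ μ ν : ComplexMeasure UnitCircle, IsFiniteMeasure μ.variation →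
      IsFiniteMeasure ν.variation → IsFiniteMeasure (μ - ν).variation := fun μ ν _ _ =>
    isFiniteMeasure_of_le _ VectorMeasure.variation_sub_le
  have h := hadd _ (Complex.I • diagComplex U (x - Complex.I • y))
    (hsub _ (Complex.I • diagComplex U (x + Complex.I • y))
      (hsub (diagComplex U (x + y)) (diagComplex U (x - y)) inferInstance inferInstance)
      inferInstance) inferInstance
  unfold spectralMeasure
  infer_instance

lemma polarIntegral_charFun (U : unitary (H →L[ℂ] H)) (x y : H) (E : Set UnitCircle)
    (hE : MeasurableSet E) : polarIntegral U x y (charFun E hE) = spectralMeasure U x y E := by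
  have h : ∀ w, diagIntegral U w (charFun E hE) = diagComplex U w E := fun w => by
    rw [diagComplex_apply U w E hE]
    exact integralₗ_charFun _ E hE
  simp only [polarIntegral, spectralMeasure, LinearMap.smul_apply, LinearMap.add_apply,
    LinearMap.sub_apply, smul_apply, add_apply, sub_apply, h]

lemma polarIntegral_eq_complexIntegral (U : unitary (H →L[ℂ] H)) (x y : H) (f : BoundedBorel) :
    polarIntegral U x y f = complexIntegral f.1 (spectralMeasure U x y) := by
  rw [(isBoundedlyContinuous_polarIntegral U x y).ext_charFun
    (isBoundedlyContinuous_complexIntegralₗ (spectralMeasure U x y)) fun E hE => by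
      rw [polarIntegral_charFun, complexIntegralₗ_charFun]]
  rfl

/-! ### Projection valued measure, null sets and norms -/

namespace IsMeasurableCalculus

variable {U : unitary (H →L[ℂ] H)} {Λ : BoundedBorel →ₗ[ℂ] (H →L[ℂ] H)}

/-- Multiplicativity and the adjoint rule turn the left side into the coefficient of the function
|f|² at x. -/
lemma norm_apply_sq (hΛ : IsMeasurableCalculus U Λ) (f : BoundedBorel) (x : H) :
    ‖Λ f x‖ ^ 2 = ∫ z, ‖f.1 z‖ ^ 2 ∂diagMeasure U x := by
  have h : inner ℂ (Λ f x) (Λ f x) = inner ℂ x (Λ (star f * f) x) := by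
    rw [hΛ.mul_apply, ← hΛ.star_apply, mul_apply_eq_comp, ContinuousLinearMap.star_eq_adjoint,
      ContinuousLinearMap.adjoint_inner_right]
  have h2 : ∫ z, (star f * f).1 z ∂diagMeasure U x =
      ((∫ z, ‖f.1 z‖ ^ 2 ∂diagMeasure U x : ℝ) : ℂ) := by
    rw [← integral_complex_ofReal]
    refine integral_congr_ae (ae_of_all _ fun z => ?_)
    change conj (f.1 z) * f.1 z = _
    exact (Complex.conj_mul' _).trans (Complex.ofReal_pow _ 2).symm
  rw [hΛ.inner_self_apply, h2, inner_self_eq_norm_sq_to_K] at h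
  exact Complex.ofReal_injective ((Complex.ofReal_pow _ 2).trans h)

lemma inner_pvm (hΛ : IsMeasurableCalculus U Λ) {E : Set UnitCircle} (hE : MeasurableSet E)
    (x y : H) : inner ℂ x (pvm Λ E y) = spectralMeasure U x y E := by
  rw [pvm_of_measurableSet Λ hE, hΛ.inner_apply, polarIntegral_charFun]

lemma norm_pvm_sq (hΛ : IsMeasurableCalculus U Λ) {E : Set UnitCircle} (hE : MeasurableSet E)
    (x : H) : ‖pvm Λ E x‖ ^ 2 = (diagMeasure U x).real E := by
  rw [pvm_of_measurableSet Λ hE, hΛ.norm_apply_sq, ← integral_indicator_one hE]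
  refine integral_congr_ae (ae_of_all _ fun z => ?_)
  by_cases hz : z ∈ E <;> simp [BoundedBorel.charFun, hz]

lemma pvm_eq_zero_iff (hΛ : IsMeasurableCalculus U Λ) {E : Set UnitCircle}
    (hE : MeasurableSet E) : pvm Λ E = 0 ↔ ∀ x, diagMeasure U x E = 0 := by
  have h : ∀ x, diagMeasure U x E = 0 ↔ pvm Λ E x = 0 := fun x => by
    rw [← measureReal_eq_zero_iff, ← hΛ.norm_pvm_sq hE, sq_eq_zero_iff, norm_eq_zero]
  simp only [h, ContinuousLinearMap.ext_iff, zero_apply]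

lemma pvm_eq_zero_iff_spectralMeasure (hΛ : IsMeasurableCalculus U Λ) {E : Set UnitCircle}
    (hE : MeasurableSet E) : pvm Λ E = 0 ↔ ∀ x y, spectralMeasure U x y E = 0 := by
  refine ⟨fun h x y => by rw [← hΛ.inner_pvm hE, h, zero_apply, inner_zero_right], fun h => ?_⟩
  ext y
  exact ext_inner_left ℂ fun x => by rw [hΛ.inner_pvm hE, h, zero_apply, inner_zero_right]

lemma pvm_eq_zero_iff_hilbertBasis (hΛ : IsMeasurableCalculus U Λ) {E : Set UnitCircle}
    (hE : MeasurableSet E) {ι : Type*} (e : HilbertBasis ι ℂ H) :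
    pvm Λ E = 0 ↔ ∀ α β, spectralMeasure U (e α) (e β) E = 0 := by
  refine ⟨fun h α β => (hΛ.pvm_eq_zero_iff_spectralMeasure hE).1 h _ _, fun h => ?_⟩
  refine ContinuousLinearMap.ext_on
    (Submodule.dense_iff_topologicalClosure_eq_top.2 e.dense_span) ?_
  rintro _ ⟨β, rfl⟩
  refine e.repr.injective ?_
  ext α
  rw [HilbertBasis.repr_apply_apply, HilbertBasis.repr_apply_apply, hΛ.inner_pvm hE, h, zero_apply,
    inner_zero_right]

lemma hasSum_pvm (hΛ : IsMeasurableCalculus U Λ) {E : ℕ → Set UnitCircle}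
    (hE : ∀ n, MeasurableSet (E n)) (hd : Pairwise (Function.onFun Disjoint E)) (y : H) :
    HasSum (fun n => pvm Λ (E n) y) (pvm Λ (⋃ n, E n) y) := by
  have hU : MeasurableSet (⋃ n, E n) := MeasurableSet.iUnion hE
  have hUs : ∀ s : Finset ℕ, MeasurableSet (⋃ n ∈ s, E n) :=
    fun s => s.measurableSet_biUnion fun n _ => hE n
  have hD : ∀ s : Finset ℕ, MeasurableSet ((⋃ n, E n) \ ⋃ n ∈ s, E n) := fun s => hU.diff (hUs s)
  have hsub : ∀ s : Finset ℕ, (⋃ n ∈ s, E n) ⊆ ⋃ n, E n :=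
    fun s => Set.iUnion₂_subset fun i _ => Set.subset_iUnion E i
  have hdec : ∀ s : Finset ℕ, pvm Λ (⋃ n, E n) y =
      ∑ n ∈ s, pvm Λ (E n) y + pvm Λ ((⋃ n, E n) \ ⋃ n ∈ s, E n) y := by
    intro s
    have hchar : charFun _ hU = ∑ n ∈ s, charFun (E n) (hE n) + charFun _ (hD s) := by
      ext z
      have h1 : (∑ n ∈ s, charFun (E n) (hE n) : BoundedBorel).1 z =
          (⋃ n ∈ s, E n).indicator 1 z := by
        rw [Finset.indicator_biUnion _ _ (fun i _ j _ hij => hd hij)]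
        simp [BoundedBorel.charFun]
      change (⋃ n, E n).indicator 1 z = (∑ n ∈ s, charFun (E n) (hE n) : BoundedBorel).1 z +
        ((⋃ n, E n) \ ⋃ n ∈ s, E n).indicator 1 z
      conv_lhs => rw [← Set.union_sdiff_cancel (hsub s),
        Set.indicator_union_of_disjoint Set.disjoint_sdiff_right]
      rw [h1]
    simp only [pvm_of_measurableSet Λ hU, pvm_of_measurableSet Λ (hD s),
      fun n => pvm_of_measurableSet Λ (hE n)]
    rw [hchar, map_add, map_sum, add_apply, sum_apply]
  have hmeas : ∀ s : Finset ℕ, (diagMeasure U y).real ((⋃ n, E n) \ ⋃ n ∈ s, E n) =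
      (diagMeasure U y).real (⋃ n, E n) - ∑ n ∈ s, (diagMeasure U y).real (E n) := by
    intro s
    rw [measureReal_sdiff (hsub s) (hUs s), measureReal_biUnion_finset (fun i _ j _ hij => hd hij)
      fun n _ => hE n]
  have hreal : HasSum (fun n => (diagMeasure U y).real (E n))
      ((diagMeasure U y).real (⋃ n, E n)) := by
    have h := (diagMeasure U y).toSignedMeasure.hasSum_of_disjoint_iUnion hE hd
    simpa only [Measure.toSignedMeasure_apply_measurable, hE, hU] using h
  rw [HasSum, tendsto_iff_norm_sub_tendsto_zero]
  -- The error is the projection of the uncovered part applied to y. Its squared norm is a scalar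
  -- measure, so strong convergence reduces to countable additivity of that measure.
  have hnorm : ∀ s : Finset ℕ, ‖∑ n ∈ s, pvm Λ (E n) y - pvm Λ (⋃ n, E n) y‖ =
      √((diagMeasure U y).real (⋃ n, E n) - ∑ n ∈ s, (diagMeasure U y).real (E n)) := by
    intro s
    rw [hdec s, sub_add_cancel_left, norm_neg, ← hmeas s, ← hΛ.norm_pvm_sq (hD s),
      Real.sqrt_sq (norm_nonneg _)]
  simp only [hnorm]
  have h := (Real.continuous_sqrt.tendsto _).comp
    (tendsto_const_nhds (x := (diagMeasure U y).real (⋃ n, E n)) |>.sub hreal)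
  rw [sub_self, Real.sqrt_zero] at h
  exact h

lemma isProjectionValuedMeasure (hΛ : IsMeasurableCalculus U Λ) :
    IsProjectionValuedMeasure (pvm Λ) where
  isStarProjection E hE := by
    rw [pvm_of_measurableSet Λ hE]
    constructor
    · rw [IsIdempotentElem, ← hΛ.mul_apply]
      congr 1
      ext z
      by_cases hz : z ∈ E <;> simp [BoundedBorel.charFun, hz]
    · rw [IsSelfAdjoint, hΛ.star_apply]
      congr 1
      ext z
      by_cases hz : z ∈ E <;> simp [BoundedBorel.charFun, hz]
  empty := (hΛ.pvm_eq_zero_iff MeasurableSet.empty).2 fun x => measure_empty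
  univ := by
    rw [pvm_of_measurableSet Λ MeasurableSet.univ, ← map_one (contCalc U), ← hΛ.extends_contCalc]
    congr 1
    ext z
    simp [BoundedBorel.charFun, ofContinuous]
  hasSum_iUnion E hE hd y := hΛ.hasSum_pvm hE hd y

lemma measurableSet_not_enorm_le {φ : UnitCircle → ℂ} (hφ : Measurable φ) (C : ℝ≥0∞) :
    MeasurableSet {z | ¬ ‖φ z‖ₑ ≤ C} :=
  (measurableSet_le hφ.enorm measurable_const).compl

/-- The single set where |φ| exceeds the supremum is null for every diagonal measure, so no
uncountable union of null sets arises. -/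
lemma linftyNorm_pvm (hΛ : IsMeasurableCalculus U Λ) {φ : UnitCircle → ℂ} (hφ : Measurable φ) :
    linftyNorm (pvm Λ) φ = ⨆ x : H, eLpNorm φ ∞ (diagMeasure U x) := by
  refine le_antisymm (sInf_le ⟨measurableSet_not_enorm_le hφ _, ?_⟩)
    (iSup_le fun x => le_sInf fun C hC => ?_)
  · refine (hΛ.pvm_eq_zero_iff (measurableSet_not_enorm_le hφ _)).2 fun x => ?_
    refine ae_iff.1 ?_
    filter_upwards [enorm_ae_le_eLpNormEssSup φ (diagMeasure U x)] with z hz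
    rw [← eLpNorm_exponent_top] at hz
    exact hz.trans (le_iSup (fun x => eLpNorm φ ∞ (diagMeasure U x)) x)
  · rw [eLpNorm_exponent_top]
    exact eLpNormEssSup_le_of_ae_enorm_bound (ae_iff.2 ((hΛ.pvm_eq_zero_iff hC.1).1 hC.2 x))

/-- If |f| ≤ C almost everywhere, integrating |f|² ≤ C² against a measure of mass ‖x‖² bounds
‖f(U)x‖². -/
lemma enorm_apply_le (hΛ : IsMeasurableCalculus U Λ) (f : BoundedBorel) :
    ‖Λ f‖ₑ ≤ linftyNorm (pvm Λ) f.1 := by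
  refine le_sInf fun C hC => ?_
  induction C with
  | top => exact le_top
  | coe C =>
    rw [enorm_eq_nnnorm, ENNReal.coe_le_coe, ← NNReal.coe_le_coe, coe_nnnorm]
    refine ContinuousLinearMap.opNorm_le_bound _ C.2 fun x => ?_
    refine le_of_sq_le_sq ?_ (by positivity)
    rw [hΛ.norm_apply_sq, mul_pow, ← diagMeasure_real_univ U x, mul_comm, ← smul_eq_mul,
      ← integral_const]
    refine integral_mono_of_nonneg (ae_of_all _ fun z => by positivity) (integrable_const _) ?_
    have h : ∀ᵐ z ∂diagMeasure U x, ‖f.1 z‖ₑ ≤ C := ae_iff.2 ((hΛ.pvm_eq_zero_iff hC.1).1 hC.2 x)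
    filter_upwards [h] with z hz
    have hz' : ‖f.1 z‖ ≤ C := by
      rwa [enorm_eq_nnnorm, ENNReal.coe_le_coe, ← NNReal.coe_le_coe, coe_nnnorm] at hz
    exact pow_le_pow_left₀ (norm_nonneg _) hz' 2

/-- On the set E where |f| exceeds the operator norm, testing f(U) on the range of χ_E(U) shows that
|f|² − ‖f(U)‖² has nonpositive integral over E. It is positive there, so E is null. -/
lemma linftyNorm_le_enorm (hΛ : IsMeasurableCalculus U Λ) (f : BoundedBorel) :
    linftyNorm (pvm Λ) f.1 ≤ ‖Λ f‖ₑ := by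
  have hE := measurableSet_not_enorm_le (measurable f) ‖Λ f‖ₑ
  set E := {z | ¬ ‖f.1 z‖ₑ ≤ ‖Λ f‖ₑ}
  refine sInf_le ⟨hE, (hΛ.pvm_eq_zero_iff hE).2 fun x => ?_⟩
  have hlt : ∀ z ∈ E, ‖Λ f‖ < ‖f.1 z‖ := fun z hz => by
    have hz' : ¬ ‖f.1 z‖ₑ ≤ ‖Λ f‖ₑ := hz
    rwa [enorm_le_iff_norm_le, not_le] at hz'
  have hle : ‖Λ (f * charFun E hE) x‖ ^ 2 ≤ ‖Λ f‖ ^ 2 * ‖Λ (charFun E hE) x‖ ^ 2 := by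
    rw [hΛ.mul_apply, ← mul_pow]
    exact pow_le_pow_left₀ (norm_nonneg _) ((Λ f).le_opNorm _) 2
  have hint : ∀ g : BoundedBorel, Integrable (fun z => ‖g.1 z‖ ^ 2) (diagMeasure U x) := by
    intro g
    convert (integrable (star g * g) (diagMeasure U x)).norm using 2 with z
    change _ = ‖conj (g.1 z) * g.1 z‖
    rw [norm_mul, RCLike.norm_conj, sq]
  rw [hΛ.norm_apply_sq, hΛ.norm_apply_sq, ← integral_const_mul, ← sub_nonpos,
    ← integral_sub (hint _) ((hint _).const_mul _)] at hle
  set h : UnitCircle → ℝ := fun z => ‖(f * charFun E hE).1 z‖ ^ 2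
    - ‖Λ f‖ ^ 2 * ‖(charFun E hE).1 z‖ ^ 2 with hh
  have hhE : ∀ z ∈ E, 0 < h z := by
    intro z hz
    have e1 : (charFun E hE).1 z = 1 := Set.indicator_of_mem hz 1
    have e2 : (f * charFun E hE).1 z = f.1 z * (charFun E hE).1 z := rfl
    simp only [hh, e2, e1, mul_one, norm_one, one_pow, sub_pos]
    exact pow_lt_pow_left₀ (hlt z hz) (norm_nonneg _) two_ne_zero
  have hhE' : ∀ z ∉ E, h z = 0 := by
    intro z hz
    have e1 : (charFun E hE).1 z = 0 := Set.indicator_of_notMem hz 1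
    simp [hh, e1]
  have hnonneg : 0 ≤ h := fun z => by
    by_cases hz : z ∈ E
    · exact (hhE z hz).le
    · exact (hhE' z hz).ge
  have hzero := (integral_eq_zero_iff_of_nonneg hnonneg
    ((hint _).sub ((hint _).const_mul _))).1 (le_antisymm hle (integral_nonneg hnonneg))
  refine measure_mono_null (fun z hz => ?_) (ae_iff.1 hzero)
  exact (hhE z hz).ne'

end IsMeasurableCalculus

end UnitaryCalculus

end

open UnitaryCalculus in
theorem mainTheorem5 {H : Type*} [NormedAddCommGroup H] [InnerProductSpace ℂ H] [CompleteSpace H]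
    (U : unitary (H →L[ℂ] H)) :
    -- existence and uniqueness of the measurable calculus
    (∃! Λ : BoundedBorel →ₗ[ℂ] (H →L[ℂ] H), IsMeasurableCalculus U Λ) ∧
    ∀ Λ : BoundedBorel →ₗ[ℂ] (H →L[ℂ] H), IsMeasurableCalculus U Λ →
      -- it is a homomorphism of star-algebras
      (∀ f g : BoundedBorel, Λ (f * g) = Λ f * Λ g) ∧
      (∀ f : BoundedBorel, star (Λ f) = Λ (star f)) ∧
      -- it is given by integration against the spectral measures
      (∀ (f : BoundedBorel) (x y : H), (spectralMeasure U x y).Integrable f.1 ∧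
        inner ℂ x (Λ f y) = complexIntegral f.1 (spectralMeasure U x y)) ∧
      -- the operators `χ_E(U)` form a projection valued measure
      IsProjectionValuedMeasure (pvm Λ) ∧
      (∀ E : Set UnitCircle, MeasurableSet E → ∀ x y : H,
        inner ℂ x (pvm Λ E y) = spectralMeasure U x y E) ∧
      -- its null sets
      (∀ E : Set UnitCircle, MeasurableSet E →
        [pvm Λ E = 0,
          ∀ x : H, diagMeasure U x E = 0,
          ∀ x y : H, spectralMeasure U x y E = 0].TFAE ∧
        ∀ (ι : Type*) (e : HilbertBasis ι ℂ H),
          (pvm Λ E = 0 ↔ ∀ α β : ι, spectralMeasure U (e α) (e β) E = 0)) ∧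
      -- its essential supremum norm
      (∀ φ : UnitCircle → ℂ, Measurable φ →
        linftyNorm (pvm Λ) φ = ⨆ x : H, eLpNorm φ ∞ (diagMeasure U x)) ∧
      (∀ f : BoundedBorel, ‖Λ f‖ₑ = linftyNorm (pvm Λ) f.1) := by
  refine ⟨?_, fun Λ hΛ => ⟨hΛ.mul_apply, hΛ.star_apply,
    fun f x y => ⟨BoundedBorel.integrable f _, ?_⟩,
    hΛ.isProjectionValuedMeasure, fun E hE x y => hΛ.inner_pvm hE x y, fun E hE => ⟨?_, ?_⟩,
    fun φ hφ => hΛ.linftyNorm_pvm hφ,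
    fun f => le_antisymm (hΛ.enorm_apply_le f) (hΛ.linftyNorm_le_enorm f)⟩⟩
  · obtain ⟨Λ, hΛ⟩ := exists_isMeasurableCalculus U
    exact ⟨Λ, hΛ, fun Λ' hΛ' => hΛ'.unique hΛ⟩
  · rw [hΛ.inner_apply, polarIntegral_eq_complexIntegral]
  · tfae_have 1 ↔ 2 := hΛ.pvm_eq_zero_iff hE
    tfae_have 1 ↔ 3 := hΛ.pvm_eq_zero_iff_spectralMeasure hE
    tfae_finish
  · exact fun ι e => hΛ.pvm_eq_zero_iff_hilbertBasis hE e
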